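/- Assume the continuum hypothesis ($\mathfrak{c}=\omega_1$). Let $X$ be a real Banach space with $\operatorname{dens} X=\operatorname{dens} X^*=\omega_1$, where $X^*$ is the normed dual of $X$ and $\operatorname{dens}$ denotes the least cardinality of a norm-dense subset. A set is called linearly dense in $X$ if its closed linear span is $X$; a set $S\subseteq X$ with $|S|=\operatorname{dens} X$ is called overcomplete if every $\Lambda\subseteq S$ with $|\Lambda|=|S|$ is linearly dense in $X$; a set is called relatively weakly compact if its closure in the weak topology is weakly compact; and $X$ is called weakly compactly generated (WCG) if it contains a linearly dense, weakly compact subset. Then (i) $X$ is WCG if and only if it contains a relatively weakly compact overcomplete set; (ii) $X$ is reflexive if and only if every bounded overcomplete set in $X$ is relatively weakly compact. -/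

import Mathlib

open scoped Cardinal

/-- The density character of a topological space: the least cardinality of a dense subset. -/
noncomputable def densityCharacter (T : Type*) [TopologicalSpace T] : Cardinal :=
  sInf {c | ∃ D : Set T, Dense D ∧ #D = c}

section BanachNotions

variable {X : Type*} [NormedAddCommGroup X] [NormedSpace ℝ X]

/-- A set is linearly dense if its closed linear span is the whole space. -/
def IsLinearlyDense (S : Set X) : Prop :=
  Dense (Submodule.span ℝ S : Set X)

/-- A set of cardinality `dens X` is overcomplete if each of its subsets of the same cardinality
is linearly dense. -/
def IsOvercomplete (S : Set X) : Prop :=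
  #S = densityCharacter X ∧ ∀ Λ : Set X, Λ ⊆ S → #Λ = #S → IsLinearlyDense Λ

/-- Compactness in the weak topology. -/
def IsWeaklyCompact (K : Set X) : Prop :=
  IsCompact (toWeakSpace ℝ X '' K)

/-- The closure in the weak topology is compact in the weak topology. -/
def IsRelativelyWeaklyCompact (S : Set X) : Prop :=
  IsCompact (closure (toWeakSpace ℝ X '' S))

variable (X)

/-- Weakly compactly generated: some weakly compact subset is linearly dense. -/
def IsWCG : Prop :=
  ∃ K : Set X, IsWeaklyCompact K ∧ IsLinearlyDense K

/-- Reflexivity: the canonical map into the bidual is onto. -/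
def IsReflexiveSpace : Prop :=
  Function.Surjective (NormedSpace.inclusionInDoubleDual ℝ X)

end BanachNotions

open Set Filter Topology Cardinal

/-! ### Density character and cardinal arithmetic under CH -/

section DensityCharacter

/-! Under CH the dual has at most `ℵ₁ ^ ℵ₀ = ℵ₁` elements, so its functionals embed in `ω₁`. Choose
points `x i`, indexed by `ω₁`, off the kernels of the countably many nonzero functionals preceding
`i`. Each nonzero functional then kills only countably many `x i`, so by Hahn–Banach every
uncountable subfamily is linearly dense. The points may be drawn from any sets not covered by
countably many such kernels (`exists_isOvercomplete_selection`). For (i), draw from a weakly compact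
set of series over a generating set; for (ii), from small balls with centres dense in the unit ball.
In (ii), relative weak compactness of the result makes the unit ball weakly compact, hence `X`
reflexive. -/

theorem exists_dense_mk_eq_densityCharacter (T : Type*) [TopologicalSpace T] :
    ∃ D : Set T, Dense D ∧ #D = densityCharacter T :=
  csInf_mem (s := {c | ∃ D : Set T, Dense D ∧ #D = c}) ⟨_, univ, dense_univ, rfl⟩

theorem densityCharacter_le_mk {T : Type*} [TopologicalSpace T] {D : Set T} (hD : Dense D) :
    densityCharacter T ≤ #D :=
  csInf_le' ⟨D, hD, rfl⟩

theorem not_separableSpace_of_densityCharacter {T : Type*} [TopologicalSpace T]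
    (h : densityCharacter T = ℵ₁) : ¬ TopologicalSpace.SeparableSpace T := by
  intro hs
  obtain ⟨D, hDc, hD⟩ := TopologicalSpace.exists_countable_dense T
  have h1 := densityCharacter_le_mk hD
  rw [h] at h1
  exact absurd (lt_aleph_one_iff.2 (le_aleph0_iff_set_countable.2 hDc)) (not_lt.2 h1)

theorem mk_le_mk_dense_power_aleph0 {T : Type*} [MetricSpace T] {D : Set T} (hD : Dense D) :
    #T ≤ #D ^ ℵ₀ := by
  have h : ∀ y : T, ∃ u : ℕ → D, Tendsto (fun n => (u n : T)) atTop (𝓝 y) := by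
    intro y
    obtain ⟨u, hu, hlim⟩ := mem_closure_iff_seq_limit.1 (hD y)
    exact ⟨fun n => ⟨u n, hu n⟩, hlim⟩
  choose u hu using h
  have hinj : Function.Injective u := fun y z hyz =>
    tendsto_nhds_unique (hu y) (hyz ▸ hu z)
  have := Cardinal.mk_le_of_injective hinj
  simpa using this

theorem aleph_one_eq_continuum_lift (hCH : (ℵ₁ : Cardinal.{0}) = 𝔠) :
    (ℵ₁ : Cardinal.{u}) = 𝔠 := by
  have := congrArg Cardinal.lift.{u} hCH
  simpa using this

theorem mk_le_aleph_one_of_densityCharacter (hCH : (ℵ₁ : Cardinal.{0}) = 𝔠)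
    {T : Type*} [MetricSpace T] (h : densityCharacter T = ℵ₁) : #T ≤ ℵ₁ := by
  obtain ⟨D, hD, hc⟩ := exists_dense_mk_eq_densityCharacter T
  refine (mk_le_mk_dense_power_aleph0 hD).trans ?_
  rw [hc, h, aleph_one_eq_continuum_lift hCH, continuum_power_aleph0]

theorem countable_Iio_ord_aleph_one_toType (a : (ℵ₁ : Cardinal.{u}).ord.ToType) :
    (Iio a).Countable := by
  rw [← le_aleph0_iff_set_countable, ← lt_aleph_one_iff]
  simpa using mk_Iio_lt a

end DensityCharacter

/-! ### Linear density and overcomplete selections -/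

section LinearDensity

variable {X : Type*} [NormedAddCommGroup X] [NormedSpace ℝ X]

theorem isLinearlyDense_of_forall_dual {S : Set X}
    (h : ∀ f : StrongDual ℝ X, (∀ x ∈ S, f x = 0) → f = 0) : IsLinearlyDense S := by
  by_contra hS
  obtain ⟨x, hx⟩ : ∃ x, x ∉ closure (Submodule.span ℝ S : Set X) := by
    simpa [IsLinearlyDense, Dense] using hS
  obtain ⟨f, u, hfx, hfu⟩ := geometric_hahn_banach_point_closed
    (Submodule.convex (Submodule.span ℝ S)).closure isClosed_closure hx
  have hu : u < 0 := by simpa using hfu 0 (subset_closure (Submodule.zero_mem _))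
  have hf : f = 0 := by
    refine h f fun y hy => ?_
    by_contra hne
    -- The multiple is scaled so that `f` takes exactly the value `u`, against the strict bound.
    have := hfu ((u / f y) • y)
      (subset_closure (Submodule.smul_mem _ _ (Submodule.subset_span hy)))
    simp [hne] at this
  simp only [hf, _root_.zero_apply] at hfx
  exact lt_asymm hu hfx

theorem IsLinearlyDense.exists_dual_ne_zero {S : Set X} (hS : IsLinearlyDense S)
    {f : StrongDual ℝ X} (hf : f ≠ 0) : ∃ x ∈ S, f x ≠ 0 := by
  by_contra! h
  refine hf (ContinuousLinearMap.ext_on hS fun x hx => ?_)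
  simp [h x hx]

theorem IsLinearlyDense.mono {S T : Set X} (hS : IsLinearlyDense S) (h : S ⊆ T) :
    IsLinearlyDense T :=
  Dense.mono (Submodule.span_mono h) hS

theorem IsLinearlyDense.separableSpace {S : Set X} (hS : IsLinearlyDense S) (hc : S.Countable) :
    TopologicalSpace.SeparableSpace X := by
  have := (hc.isSeparable.span (R := ℝ)).closure
  rw [hS.closure_eq] at this
  exact TopologicalSpace.isSeparable_univ_iff.1 this

theorem IsOvercomplete.isLinearlyDense {S : Set X} (hS : IsOvercomplete S) : IsLinearlyDense S :=
  hS.2 S Subset.rfl rfl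

theorem isOvercomplete_range {ι : Type u} {X : Type u} [NormedAddCommGroup X] [NormedSpace ℝ X]
    (hX : densityCharacter X = ℵ₁) (hι : #ι = ℵ₁) (x : ι → X)
    (h : ∀ f : StrongDual ℝ X, f ≠ 0 → {i | f (x i) = 0}.Countable) :
    IsOvercomplete (range x) := by
  have key : ∀ A : Set ι, ¬ A.Countable → IsLinearlyDense (x '' A) := by
    intro A hA
    refine isLinearlyDense_of_forall_dual fun f hf => ?_
    by_contra hne
    exact hA ((h f hne).mono fun i hi => hf _ (mem_image_of_mem x hi))
  -- `x` need not be injective, but a countable range would make `X` separable.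
  have hrange : #(range x) = ℵ₁ := by
    refine le_antisymm (hι ▸ mk_range_le) (not_lt.1 fun hlt => ?_)
    have hc := le_aleph0_iff_set_countable.1 (lt_aleph_one_iff.1 hlt)
    refine not_separableSpace_of_densityCharacter hX (IsLinearlyDense.separableSpace ?_ hc)
    rw [← image_univ]
    refine key univ ?_
    rw [← le_aleph0_iff_set_countable, ← lt_aleph_one_iff, mk_univ, hι]
    exact lt_irrefl _
  refine ⟨hrange.trans hX.symm, fun Λ hΛ hc => ?_⟩
  rw [← image_preimage_eq_of_subset hΛ]
  refine key _ fun hcount => ?_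
  have := hcount.image x
  rw [image_preimage_eq_of_subset hΛ, ← le_aleph0_iff_set_countable, ← lt_aleph_one_iff, hc, hrange] at this
  exact lt_irrefl _ this

/-- Under the continuum hypothesis, a family of sets each of which contains points avoiding any
given countable family of closed hyperplanes has an overcomplete selection. -/
theorem exists_isOvercomplete_selection (hCH : (ℵ₁ : Cardinal.{0}) = 𝔠)
    {ι X : Type u} [NormedAddCommGroup X] [NormedSpace ℝ X]
    (hX : densityCharacter X = ℵ₁) (hX' : densityCharacter (StrongDual ℝ X) = ℵ₁)
    (hι : #ι = ℵ₁) (U : ι → Set X)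
    (hU : ∀ i, ∀ s : Set (StrongDual ℝ X), s.Countable → (∀ f ∈ s, f ≠ 0) →
      ∃ x ∈ U i, ∀ f ∈ s, f x ≠ 0) :
    ∃ x : ι → X, (∀ i, x i ∈ U i) ∧ IsOvercomplete (range x) := by
  let W := (ℵ₁ : Cardinal.{u}).ord.ToType
  have hW : #W = ℵ₁ := mk_ord_toType _
  obtain ⟨r⟩ : Nonempty (ι ≃ W) := Cardinal.eq.1 (hι.trans hW.symm)
  obtain ⟨e⟩ : Nonempty (StrongDual ℝ X ↪ W) :=
    (mk_le_aleph_one_of_densityCharacter hCH hX').trans_eq hW.symm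
  -- The constraint ignores earlier points, so plain choice replaces recursion.
  have hs : ∀ i, ∃ x ∈ U i, ∀ f : StrongDual ℝ X, f ≠ 0 → e f < r i → f x ≠ 0 := by
    intro i
    obtain ⟨x, hx, hx'⟩ := hU i ({f | f ≠ 0} ∩ e ⁻¹' Iio (r i))
      (((countable_Iio_ord_aleph_one_toType _).preimage e.injective).mono inter_subset_right)
      fun f hf => hf.1
    exact ⟨x, hx, fun f hf hlt => hx' f ⟨hf, hlt⟩⟩
  choose x hxU hx using hs
  refine ⟨x, hxU, isOvercomplete_range hX hι x fun f hf => ?_⟩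
  have hc : (Iic (e f)).Countable := by
    rw [← Iio_insert]
    exact (countable_Iio_ord_aleph_one_toType _).insert _
  refine (hc.preimage r.injective).mono fun i hi => ?_
  by_contra hlt
  exact hx i f hf (not_le.1 hlt) hi

end LinearDensity

/-! ### Baire category: points off countably many kernels -/

section GenericPoints

variable {X : Type*} [NormedAddCommGroup X] [NormedSpace ℝ X]

theorem exists_mem_open_forall_dual_ne_zero [CompleteSpace X] {U : Set X} (hU : IsOpen U)
    (hne : U.Nonempty) {s : Set (StrongDual ℝ X)} (hs : s.Countable) (h0 : ∀ f ∈ s, f ≠ 0) :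
    ∃ x ∈ U, ∀ f ∈ s, f x ≠ 0 := by
  have hd : Dense (⋂ f ∈ s, (fun x => f x) ⁻¹' {0}ᶜ) := by
    refine dense_biInter_of_isOpen (fun f _ => isOpen_compl_singleton.preimage f.continuous) hs
      fun f hf => ?_
    exact (dense_compl_singleton (0 : ℝ)).preimage (f.isOpenMap_of_ne_zero (h0 f hf))
  obtain ⟨x, hxU, hx⟩ := hd.inter_open_nonempty U hU hne
  exact ⟨x, hxU, by simpa using hx⟩

/-- Moving coordinate `n` slightly changes `g` by a nonzero amount, so `g` cannot vanish both before
and after. -/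
theorem dense_ne_of_forall_update {g : (ℕ → unitInterval) → ℝ} {n : ℕ} {c : ℝ} (hc : c ≠ 0)
    (h : ∀ a s t, g (Function.update a n s) - g (Function.update a n t) = c * ((s : ℝ) - t)) :
    Dense {a | g a ≠ 0} := by
  refine dense_iff_inter_open.2 fun U hU ⟨a, ha⟩ => ?_
  let V : Set unitInterval := (fun t => Function.update a n t) ⁻¹' U
  have hV : IsOpen V := hU.preimage (by fun_prop)
  have haV : a n ∈ V := by simpa [V] using ha
  obtain ⟨t, htV, ht⟩ : ∃ t ∈ V, t ≠ a n := by
    have h1 : ∀ᶠ t in 𝓝[≠] (a n), t ∈ V ∧ t ≠ a n :=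
      (eventually_nhdsWithin_of_eventually_nhds (hV.mem_nhds haV)).and self_mem_nhdsWithin
    exact h1.exists
  by_cases h0 : g (Function.update a n t) = 0
  · refine ⟨_, haV, fun h1 => ?_⟩
    have h2 := h a t (a n)
    simp only [h0, h1, sub_zero] at h2
    rcases mul_eq_zero.1 h2.symm with h3 | h3
    · exact hc h3
    · exact ht (Subtype.ext (sub_eq_zero.1 h3))
  · exact ⟨_, htV, h0⟩

/-- The series `∑ 2⁻ᵐ aₘ kₘ`. -/
noncomputable def weightedSeries (a : ℕ → unitInterval) (k : ℕ → X) : X :=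
  ∑' m, ((1 / 2 : ℝ) ^ m * (a m : ℝ)) • k m

theorem norm_weightedSeries_term_le {M : ℝ} (a : unitInterval) {y : X} (hy : ‖y‖ ≤ M) (m : ℕ) :
    ‖((1 / 2 : ℝ) ^ m * (a : ℝ)) • y‖ ≤ (1 / 2 : ℝ) ^ m * M := by
  rw [norm_smul, Real.norm_of_nonneg (mul_nonneg (by positivity) a.2.1)]
  refine mul_le_mul ?_ hy (norm_nonneg _) (by positivity)
  exact mul_le_of_le_one_right (by positivity) a.2.2

theorem summable_weightedSeries_bound (M : ℝ) : Summable fun m : ℕ => (1 / 2 : ℝ) ^ m * M :=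
  (summable_geometric_of_lt_one (by norm_num) (by norm_num)).mul_right M

theorem dual_weightedSeries [CompleteSpace X] (f : StrongDual ℝ X) (a : ℕ → unitInterval)
    {k : ℕ → X} {M : ℝ} (hk : ∀ m, ‖k m‖ ≤ M) :
    f (weightedSeries a k) = ∑' m, (1 / 2 : ℝ) ^ m * (a m : ℝ) * f (k m) := by
  have hs : Summable fun m => ((1 / 2 : ℝ) ^ m * (a m : ℝ)) • k m :=
    (summable_weightedSeries_bound M).of_norm_bounded fun m =>
      norm_weightedSeries_term_le (a m) (hk m) m
  simp_rw [weightedSeries, f.map_tsum hs, map_smul, smul_eq_mul]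

theorem norm_dual_term_le (f : StrongDual ℝ X) (a : unitInterval) {y : X} {M : ℝ}
    (hy : ‖y‖ ≤ M) (m : ℕ) :
    ‖(1 / 2 : ℝ) ^ m * (a : ℝ) * f y‖ ≤ (1 / 2 : ℝ) ^ m * (‖f‖ * M) := by
  have h := norm_weightedSeries_term_le a (f.le_of_opNorm_le_of_le le_rfl hy) m
  simpa only [smul_eq_mul] using h

/-- Baire category in the cube of coefficients: the `n`-th condition is open, and dense because
coordinate `n` alone can enforce it. -/
theorem exists_weightedSeries_forall_dual_ne_zero [CompleteSpace X] {k : ℕ → X} {M : ℝ}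
    (hk : ∀ m, ‖k m‖ ≤ M) {f : ℕ → StrongDual ℝ X} (hf : ∀ n, f n (k n) ≠ 0) :
    ∃ a : ℕ → unitInterval, ∀ n, f n (weightedSeries a k) ≠ 0 := by
  have hd : Dense (⋂ n, {a : ℕ → unitInterval | f n (weightedSeries a k) ≠ 0}) := by
    refine dense_iInter_of_isOpen (fun n => ?_) fun n => ?_
    · refine isOpen_ne.preimage (f := fun a => f n (weightedSeries a k)) ?_
      simp_rw [dual_weightedSeries (f n) _ hk]
      exact continuous_tsum (fun m => by fun_prop) (summable_weightedSeries_bound _)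
        fun m a => norm_dual_term_le (f n) (a m) (hk m) m
    · refine dense_ne_of_forall_update (n := n) (c := (1 / 2 : ℝ) ^ n * f n (k n))
        (mul_ne_zero (by positivity) (hf n)) fun a s t => ?_
      have hs : ∀ b : ℕ → unitInterval,
          Summable fun m => (1 / 2 : ℝ) ^ m * (b m : ℝ) * f n (k m) := fun b =>
        (summable_weightedSeries_bound _).of_norm_bounded fun m =>
          norm_dual_term_le (f n) (b m) (hk m) m
      rw [dual_weightedSeries _ _ hk, dual_weightedSeries _ _ hk, ← (hs _).tsum_sub (hs _),
        tsum_eq_single n]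
      · simp only [Function.update_self]
        ring
      · intro m hm
        simp [Function.update_of_ne hm]
  obtain ⟨a, ha⟩ := hd.nonempty
  exact ⟨a, by simpa using ha⟩

end GenericPoints

/-! ### Weakly compact sets and WCG spaces -/

section WeaklyCompact

variable {X : Type*} [NormedAddCommGroup X] [NormedSpace ℝ X]

theorem continuous_toWeakSpace_iff {T : Type*} [TopologicalSpace T] {g : T → X}
    (h : ∀ f : StrongDual ℝ X, Continuous fun t => f (g t)) :
    Continuous fun t => toWeakSpace ℝ X (g t) :=
  WeakBilin.continuous_of_continuous_eval _ h

theorem continuous_dual_toWeakSpace_symm (f : StrongDual ℝ X) :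
    Continuous fun y : WeakSpace ℝ X => f ((toWeakSpace ℝ X).symm y) :=
  WeakBilin.eval_continuous (topDualPairing ℝ X).flip f

theorem IsWeaklyCompact.exists_norm_le {K : Set X} (hK : IsWeaklyCompact K) :
    ∃ M, ∀ x ∈ K, ‖x‖ ≤ M := by
  obtain ⟨M, hM⟩ := banach_steinhaus (g := fun x : K => NormedSpace.inclusionInDoubleDual ℝ X x)
    (fun f => by
      obtain ⟨C, hC⟩ := hK.exists_bound_of_continuousOn
        (continuous_dual_toWeakSpace_symm f).continuousOn
      exact ⟨C, fun x => by simpa using hC _ (mem_image_of_mem _ x.2)⟩)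
  refine ⟨M, fun x hx => ?_⟩
  rw [← (NormedSpace.inclusionInDoubleDualLi ℝ (E := X)).norm_map x]
  exact hM ⟨x, hx⟩

theorem IsWeaklyCompact.insert {K : Set X} (hK : IsWeaklyCompact K) (x : X) :
    IsWeaklyCompact (insert x K) := by
  rw [IsWeaklyCompact, image_insert_eq]
  exact IsCompact.insert hK _

/-- The set is a weakly continuous image of a compact product; uniform convergence of the scalar
series gives the continuity. -/
theorem IsWeaklyCompact.weightedSeries [CompleteSpace X] {K : Set X} (hK : IsWeaklyCompact K) :
    IsWeaklyCompact
      {x | ∃ (a : ℕ → unitInterval) (k : ℕ → X), (∀ m, k m ∈ K) ∧ weightedSeries a k = x} := by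
  obtain ⟨M, hM⟩ := hK.exists_norm_le
  let K' := toWeakSpace ℝ X '' K
  have : CompactSpace K' := isCompact_iff_compactSpace.1 hK
  let κ : K' → X := fun y => (toWeakSpace ℝ X).symm y
  have hκ : ∀ y, κ y ∈ K := by
    rintro ⟨-, x, hx, rfl⟩
    simpa [κ] using hx
  have hcont : Continuous fun p : (ℕ → unitInterval) × (ℕ → K') =>
      toWeakSpace ℝ X (_root_.weightedSeries p.1 fun m => κ (p.2 m)) := by
    refine continuous_toWeakSpace_iff fun f => ?_
    simp_rw [dual_weightedSeries f _ fun m => hM _ (hκ _)]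
    refine continuous_tsum (fun m => ?_) (summable_weightedSeries_bound _)
      fun m p => norm_dual_term_le f (p.1 m) (hM _ (hκ (p.2 m))) m
    have h1 : Continuous fun p : (ℕ → unitInterval) × (ℕ → K') => f (κ (p.2 m)) :=
      (continuous_dual_toWeakSpace_symm f).comp (by fun_prop)
    exact Continuous.mul (by fun_prop) h1
  have himg := isCompact_range hcont
  unfold IsWeaklyCompact
  convert himg using 1
  ext y
  constructor
  · rintro ⟨-, ⟨a, k, hk, rfl⟩, rfl⟩
    exact ⟨(a, fun m => ⟨toWeakSpace ℝ X (k m), mem_image_of_mem _ (hk m)⟩), by simp [κ]⟩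
  · rintro ⟨p, rfl⟩
    exact mem_image_of_mem _ ⟨p.1, fun m => κ (p.2 m), fun m => hκ _, rfl⟩

theorem IsWeaklyCompact.isRelativelyWeaklyCompact_of_subset {K S : Set X}
    (hK : IsWeaklyCompact K) (h : S ⊆ K) : IsRelativelyWeaklyCompact S :=
  IsCompact.closure_of_subset hK (image_mono h)

theorem IsRelativelyWeaklyCompact.isWCG {S : Set X} (hS : IsRelativelyWeaklyCompact S)
    (hd : IsLinearlyDense S) : IsWCG X := by
  refine ⟨toWeakSpace ℝ X ⁻¹' closure (toWeakSpace ℝ X '' S), ?_, hd.mono ?_⟩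
  · rw [IsWeaklyCompact, image_preimage_eq _ (toWeakSpace ℝ X).surjective]
    exact hS
  · exact image_subset_iff.1 subset_closure

theorem IsLinearlyDense.exists_weightedSeries [CompleteSpace X] {K : Set X}
    (hd : IsLinearlyDense K) {M : ℝ} (hM : ∀ x ∈ K, ‖x‖ ≤ M) (hne : K.Nonempty)
    {s : Set (StrongDual ℝ X)} (hs : s.Countable) (h0 : ∀ f ∈ s, f ≠ 0) :
    ∃ (a : ℕ → unitInterval) (k : ℕ → X), (∀ m, k m ∈ K) ∧
      ∀ f ∈ s, f (weightedSeries a k) ≠ 0 := by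
  obtain ⟨x₀, hx₀⟩ := hne
  rcases s.eq_empty_or_nonempty with rfl | hsne
  · exact ⟨fun _ => 0, fun _ => x₀, fun _ => hx₀, by simp⟩
  obtain ⟨f, rfl⟩ := hs.exists_eq_range hsne
  choose k hk hfk using fun n => hd.exists_dual_ne_zero (h0 (f n) (mem_range_self n))
  obtain ⟨a, ha⟩ := exists_weightedSeries_forall_dual_ne_zero (fun m => hM _ (hk m)) hfk
  exact ⟨a, k, hk, by simpa using ha⟩

theorem IsWCG.exists_isOvercomplete (hCH : (ℵ₁ : Cardinal.{0}) = 𝔠) [CompleteSpace X]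
    (hX : densityCharacter X = ℵ₁) (hX' : densityCharacter (StrongDual ℝ X) = ℵ₁)
    (h : IsWCG X) : ∃ S : Set X, IsOvercomplete S ∧ IsRelativelyWeaklyCompact S := by
  obtain ⟨K, hK, hd⟩ := h
  -- Adding `0` guarantees a nonempty generating set.
  have hK₀ := hK.insert 0
  obtain ⟨M, hM⟩ := hK₀.exists_norm_le
  obtain ⟨x, hx, hover⟩ := exists_isOvercomplete_selection hCH hX hX' (mk_ord_toType ℵ₁)
    (fun _ => {x | ∃ (a : ℕ → unitInterval) (k : ℕ → X),
      (∀ m, k m ∈ insert 0 K) ∧ weightedSeries a k = x})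
    (fun _ s hs h0 => by
      obtain ⟨a, k, hk, hf⟩ := (hd.mono (subset_insert 0 K)).exists_weightedSeries hM
        (insert_nonempty _ _) hs h0
      exact ⟨_, ⟨a, k, hk, rfl⟩, hf⟩)
  exact ⟨range x, hover,
    hK₀.weightedSeries.isRelativelyWeaklyCompact_of_subset (range_subset_iff.2 hx)⟩

end WeaklyCompact

/-! ### Reflexivity -/

section Reflexive

variable {X : Type*} [NormedAddCommGroup X] [NormedSpace ℝ X]

theorem IsReflexiveSpace.isRelativelyWeaklyCompact (h : IsReflexiveSpace X) {S : Set X}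
    (hS : Bornology.IsBounded S) : IsRelativelyWeaklyCompact S := by
  refine NormedSpace.isCompact_closure_of_isBounded ℝ X _ ?_ fun φ _ => ?_
  · rwa [preimage_image_eq _ (toWeakSpace ℝ X).injective]
  · obtain ⟨x, hx⟩ := h (WeakDual.toStrongDual φ)
    exact ⟨toWeakSpace ℝ X x, hx⟩

theorem exists_eval_eq_of_dual_weakDual {E : Type*} [NormedAddCommGroup E] [NormedSpace ℝ E]
    (F : StrongDual ℝ (WeakDual ℝ E)) : ∃ e : E, ∀ φ : WeakDual ℝ E, F φ = φ e := by
  obtain ⟨e, he⟩ := LinearMap.dualEmbedding_surjective (topDualPairing ℝ E) F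
  exact ⟨e, fun φ => (DFunLike.congr_fun he φ).symm⟩

theorem exists_separating_of_notMem_weakDual {E : Type*} [NormedAddCommGroup E] [NormedSpace ℝ E]
    {B : Set (WeakDual ℝ E)} (hB : IsCompact B) (hconv : Convex ℝ B) {φ : WeakDual ℝ E}
    (hφ : φ ∉ B) : ∃ (e : E) (u : ℝ), (∀ ψ ∈ B, ψ e < u) ∧ u < φ e := by
  have : LocallyConvexSpace ℝ (WeakDual ℝ E) :=
    (WeakDual.withSeminorms ℝ E).toLocallyConvexSpace
  obtain ⟨F, u, hFu, hF⟩ := geometric_hahn_banach_closed_point hconv hB.isClosed hφ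
  obtain ⟨e, he⟩ := exists_eval_eq_of_dual_weakDual F
  exact ⟨e, u, fun ψ hψ => he ψ ▸ hFu ψ hψ, he φ ▸ hF⟩

/-- The ball's image in the bidual is weak-* compact and convex. Separating a missed `φ` with `‖φ‖ ≤
1` from it gives `f` with `‖f‖ ≤ u < φ f ≤ ‖f‖`. -/
theorem isReflexiveSpace_of_isWeaklyCompact_closedBall
    (h : IsWeaklyCompact (Metric.closedBall (0 : X) 1)) : IsReflexiveSpace X := by
  suffices hball : ∀ φ : StrongDual ℝ (StrongDual ℝ X), ‖φ‖ ≤ 1 →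
      ∃ x, NormedSpace.inclusionInDoubleDual ℝ X x = φ by
    intro φ
    rcases eq_or_ne φ 0 with rfl | hφ
    · exact ⟨0, map_zero _⟩
    have hφ' : ‖φ‖ ≠ 0 := fun h0 => hφ ((ContinuousLinearMap.opNorm_zero_iff φ).1 h0)
    have hnorm : ‖‖φ‖⁻¹ • φ‖ ≤ 1 := by
      refine (ContinuousLinearMap.opNorm_smul_le _ _).trans ?_
      rw [Real.norm_of_nonneg (inv_nonneg.2 φ.opNorm_nonneg), inv_mul_cancel₀ hφ']
    obtain ⟨x, hx⟩ := hball (‖φ‖⁻¹ • φ) hnorm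
    exact ⟨‖φ‖ • x, by rw [map_smul, hx, smul_inv_smul₀ hφ']⟩
  intro φ hφ
  let J := NormedSpace.inclusionInDoubleDualWeak ℝ X
  let B : Set (WeakDual ℝ (StrongDual ℝ X)) :=
    J '' (toWeakSpace ℝ X '' Metric.closedBall (0 : X) 1)
  have hB : IsCompact B := h.image J.continuous
  have hconv : Convex ℝ B :=
    ((convex_closedBall (0 : X) 1).linear_image (toWeakSpace ℝ X).toLinearMap).linear_image
      J.toLinearMap
  by_contra! hne
  have hφB : StrongDual.toWeakDual φ ∉ B := by
    rintro ⟨-, ⟨x, -, rfl⟩, hx⟩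
    exact hne x hx
  obtain ⟨f, u, hFu, hlt⟩ := exists_separating_of_notMem_weakDual hB hconv hφB
  have hle : ∀ x : X, ‖x‖ ≤ 1 → f x < u := fun x hx =>
    hFu _ (mem_image_of_mem _ (mem_image_of_mem _ (by simpa using hx)))
  have hu : 0 < u := by simpa using hle 0 (by simp)
  have hnorm : ‖f‖ ≤ u := by
    refine f.opNorm_le_of_unit_norm hu.le fun x hx => ?_
    rw [Real.norm_eq_abs, abs_le]
    refine ⟨?_, (hle x hx.le).le⟩
    have := hle (-x) (by simp [hx])
    rw [map_neg] at this
    linarith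
  rw [StrongDual.toWeakDual_apply] at hlt
  have : φ f ≤ 1 * ‖f‖ := (le_abs_self _).trans (φ.le_of_opNorm_le hφ f)
  linarith

theorem isReflexiveSpace_of_closedBall_subset_closure {S : Set X}
    (hS : IsRelativelyWeaklyCompact S) (h : Metric.closedBall (0 : X) 1 ⊆ closure S) :
    IsReflexiveSpace X := by
  refine isReflexiveSpace_of_isWeaklyCompact_closedBall (IsCompact.of_isClosed_subset hS ?_ ?_)
  -- Mazur: norm-closed convex sets are weakly closed.
  · rw [← Metric.isClosed_closedBall.closure_eq,
      (convex_closedBall (0 : X) 1).toWeakSpace_closure ℝ]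
    exact isClosed_closure
  · refine (image_mono h).trans ?_
    exact (toWeakSpaceCLM ℝ X).continuous.continuousOn.image_closure

theorem exists_isBounded_isOvercomplete_closedBall_subset_closure
    (hCH : (ℵ₁ : Cardinal.{0}) = 𝔠) [CompleteSpace X]
    (hX : densityCharacter X = ℵ₁) (hX' : densityCharacter (StrongDual ℝ X) = ℵ₁) :
    ∃ S : Set X, Bornology.IsBounded S ∧ IsOvercomplete S ∧
      Metric.closedBall (0 : X) 1 ⊆ closure S := by
  obtain ⟨D, hD, hc⟩ := exists_dense_mk_eq_densityCharacter X
  have hι : #(D × ℕ) = ℵ₁ := by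
    simp [hc, hX, aleph0_lt_aleph_one.le]
  classical
  -- Centres outside the open unit ball are reset to `0` to keep the selection bounded.
  let c : D → X := fun d => if ‖(d : X)‖ < 1 then d else 0
  have hcle : ∀ d, ‖c d‖ ≤ 1 := by
    intro d
    by_cases hd : ‖(d : X)‖ < 1
    · simpa [c, hd] using hd.le
    · simp [c, hd]
  obtain ⟨x, hx, hover⟩ := exists_isOvercomplete_selection hCH hX hX' hι
    (fun p => Metric.ball (c p.1) (1 / ((p.2 : ℝ) + 1)))
    (fun p s hs h0 => exists_mem_open_forall_dual_ne_zero Metric.isOpen_ball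
      ⟨c p.1, Metric.mem_ball_self (by positivity)⟩ hs h0)
  refine ⟨range x, ?_, hover, ?_⟩
  · refine isBounded_iff_forall_norm_le.2 ⟨2, ?_⟩
    rintro - ⟨p, rfl⟩
    have h1 : ‖x p - c p.1‖ < 1 / ((p.2 : ℝ) + 1) := mem_ball_iff_norm.1 (hx p)
    have h2 : 1 / ((p.2 : ℝ) + 1) ≤ 1 := by
      rw [div_le_one (by positivity)]
      linarith [Nat.cast_nonneg (α := ℝ) p.2]
    have h3 := norm_le_norm_add_norm_sub' (x p) (c p.1)
    linarith [hcle p.1]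
  · rw [← closure_ball (0 : X) one_ne_zero]
    refine closure_minimal (fun y hy => Metric.mem_closure_range_iff.2 fun ε hε => ?_)
      isClosed_closure
    obtain ⟨n, hn⟩ := exists_nat_one_div_lt (half_pos hε)
    obtain ⟨d, ⟨hd1, hdε⟩, hdD⟩ := hD.inter_open_nonempty
      (Metric.ball 0 1 ∩ Metric.ball y (ε / 2)) (Metric.isOpen_ball.inter Metric.isOpen_ball)
      ⟨y, hy, Metric.mem_ball_self (half_pos hε)⟩
    refine ⟨(⟨d, hdD⟩, n), ?_⟩
    have h1 := hx (⟨d, hdD⟩, n)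
    have hcd : c ⟨d, hdD⟩ = d := if_pos (mem_ball_zero_iff.1 hd1)
    simp only [hcd, Metric.mem_ball] at h1
    have h2 := dist_triangle_right y (x (⟨d, hdD⟩, n)) d
    rw [Metric.mem_ball, dist_comm] at hdε
    linarith

end Reflexive

theorem mainTheorem6 (hCH : (ℵ₁ : Cardinal.{0}) = 𝔠)
    (X : Type*) [NormedAddCommGroup X] [NormedSpace ℝ X] [CompleteSpace X]
    (hX : densityCharacter X = ℵ₁) (hX' : densityCharacter (StrongDual ℝ X) = ℵ₁) :
    (IsWCG X ↔ ∃ S : Set X, IsOvercomplete S ∧ IsRelativelyWeaklyCompact S) ∧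
    (IsReflexiveSpace X ↔
      ∀ S : Set X, Bornology.IsBounded S → IsOvercomplete S → IsRelativelyWeaklyCompact S) := by
  refine ⟨⟨fun h => h.exists_isOvercomplete hCH hX hX',
    fun ⟨S, hS, hSc⟩ => hSc.isWCG hS.isLinearlyDense⟩,
    fun h S hS _ => h.isRelativelyWeaklyCompact hS, fun h => ?_⟩
  obtain ⟨S, hb, hS, hball⟩ :=
    exists_isBounded_isOvercomplete_closedBall_subset_closure hCH hX hX'
  exact isReflexiveSpace_of_closedBall_subset_closure (h S hb hS) hball
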